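/- All Hilbert spaces are over a fixed scalar field, $\mathbb R$ or $\mathbb C$. A *continuous product of Hilbert spaces* consists of separable, non-zero (possibly finite-dimensional) Hilbert spaces $H_{s,t}$, given for all $s<t$ in $[-\infty,\infty]$, and unitary operators $H_{r,s}\otimes H_{s,t}\to H_{r,t}$ for all $r<s<t$ in $[-\infty,\infty]$, the image of $f\otimes g$ being denoted by $fg$, such that $(fg)h=f(gh)$ whenever $f\in H_{r,s}$, $g\in H_{s,t}$, $h\in H_{t,u}$, $r<s<t<u$. For $-\infty<s<t<\infty$ let $\mathcal A_{s,t}$ be the algebra of operators on $H_{-\infty,\infty}$ that is the image of $\mathbf 1\otimes\mathcal B(H_{s,t})\otimes\mathbf 1$ under the resulting unitary $H_{-\infty,s}\otimes H_{s,t}\otimes H_{t,\infty}\to H_{-\infty,\infty}$. The product is *homogeneous* if it is equipped with unitary operators $\theta^h_{s,t}:H_{s,t}\to H_{s+h,t+h}$ for all $h\in\mathbb R$ and $s<t$ in $[-\infty,\infty]$ (where $\pm\infty+h=\pm\infty$) such that (a) $\theta^h_{r,t}(fg)=(\theta^h_{r,s}f)(\theta^h_{s,t}g)$ for $r<s<t$,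 $f\in H_{r,s}$, $g\in H_{s,t}$; (b) $\theta^{h_2}_{s+h_1,t+h_1}\theta^{h_1}_{s,t}=\theta^{h_1+h_2}_{s,t}$; (c) $\theta^h_{-\infty,\infty}=\exp(hA)$ for all $h\in\mathbb R$, for some (possibly unbounded) densely defined operator $A$ on $H_{-\infty,\infty}$ with $A^*=-A$ (over $\mathbb C$: $\theta^h_{-\infty,\infty}=\exp(\mathrm i hX)$ with $X$ self-adjoint); (d) the union of all $\mathcal A_{s,t}$, $-\infty<s<t<\infty$, is dense in $\mathcal B(H_{-\infty,\infty})$ in the weak operator topology. A vector $f\in H_{-\infty,\infty}$ is *decomposable* if $f\ne0$ and for every $s\in(-\infty,\infty)$ there exist $g\in H_{-\infty,s}$ and $h\in H_{s,\infty}$ with $f=gh$; it is *shift-invariant* if $\theta^h_{-\infty,\infty}f=f$ for all $h\in\mathbb R$. **Proposition.** For every homogeneous continuous product of Hilbert spaces $(H_{s,t})_{s<t}$, $(\theta^h_{s,t})_{s<t;\,h}$, the linear subspace of $H_{-\infty,\infty}$ spanned by all shift-invariant decomposable vectors has dimension $0$ or $1$. -/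

import Mathlib

open scoped TensorProduct Topology
open Filter

noncomputable section

/-- `IsExpGroup A U` says that `U h = exp (h A)` for all real `h`: the family `U` of unitary operators
is a one-parameter group, and the (possibly unbounded) operator `A` is its infinitesimal generator,
i.e. `f` is in the domain of `A` with `A f = g` iff `(U h f - f) / h → g` as `h → 0`. -/
def IsExpGroup {𝕜 E : Type*} [RCLike 𝕜] [NormedAddCommGroup E] [InnerProductSpace 𝕜 E]
    (A : E →ₗ.[𝕜] E) (U : ℝ → (E ≃ₗᵢ[𝕜] E)) : Prop :=
  (∀ (h₁ h₂ : ℝ) (f : E), U (h₁ + h₂) f = U h₂ (U h₁ f)) ∧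
  ∀ f g : E, (f, g) ∈ A.graph ↔
    Tendsto (fun h : ℝ => ((h⁻¹ : ℝ) : 𝕜) • (U h f - f)) (𝓝[≠] 0) (𝓝 g)

/-- A densely defined operator `A` with `A† = -A`. Over `ℂ` these are exactly the operators
`A = i X` with `X` self-adjoint. -/
def IsSkewAdjointOperator {𝕜 E : Type*} [RCLike 𝕜] [NormedAddCommGroup E] [InnerProductSpace 𝕜 E]
    [CompleteSpace E] (A : E →ₗ.[𝕜] E) : Prop :=
  Dense (A.domain : Set E) ∧ A.adjoint = -A

/-- A continuous product of Hilbert spaces `(H s t)` over the time set `[-∞, ∞]`.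
All data and all conditions concern only the spaces `H s t` with `s < t`; the values of `H` at other
pairs are never used. The Hilbert space tensor product is the completion of the algebraic one. -/
structure ContinuousProduct (𝕜 : Type*) [RCLike 𝕜] (H : EReal → EReal → Type*)
    [∀ s t, NormedAddCommGroup (H s t)] [∀ s t, InnerProductSpace 𝕜 (H s t)]
    [∀ s t, CompleteSpace (H s t)] where
  separable : ∀ {s t : EReal}, s < t → TopologicalSpace.SeparableSpace (H s t)
  nontrivial : ∀ {s t : EReal}, s < t → Nontrivial (H s t)
  /-- the given unitary operators -/
  mulIso : ∀ {r s t : EReal}, r < s → s < t →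
    UniformSpace.Completion (H r s ⊗[𝕜] H s t) ≃ₗᵢ[𝕜] H r t
  assoc : ∀ {r s t u : EReal} (hrs : r < s) (hst : s < t) (htu : t < u)
    (f : H r s) (g : H s t) (h : H t u),
    mulIso (hrs.trans hst) htu ((mulIso hrs hst ((f ⊗ₜ[𝕜] g : H r s ⊗[𝕜] H s t) :
        UniformSpace.Completion (H r s ⊗[𝕜] H s t)) ⊗ₜ[𝕜] h : H r t ⊗[𝕜] H t u) :
        UniformSpace.Completion (H r t ⊗[𝕜] H t u)) =
      mulIso hrs (hst.trans htu) ((f ⊗ₜ[𝕜] mulIso hst htu ((g ⊗ₜ[𝕜] h : H s t ⊗[𝕜] H t u) :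
        UniformSpace.Completion (H s t ⊗[𝕜] H t u)) : H r s ⊗[𝕜] H s u) :
        UniformSpace.Completion (H r s ⊗[𝕜] H s u))

namespace ContinuousProduct

variable {𝕜 : Type*} [RCLike 𝕜] {H : EReal → EReal → Type*}
  [∀ s t, NormedAddCommGroup (H s t)] [∀ s t, InnerProductSpace 𝕜 (H s t)]
  [∀ s t, CompleteSpace (H s t)]

/-- The product `f g ∈ H r t` of `f ∈ H r s` and `g ∈ H s t`: the image of `f ⊗ g`. -/
def mul (P : ContinuousProduct 𝕜 H) {r s t : EReal} (hrs : r < s) (hst : s < t)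
    (f : H r s) (g : H s t) : H r t :=
  P.mulIso hrs hst ((f ⊗ₜ[𝕜] g : H r s ⊗[𝕜] H s t) : UniformSpace.Completion (H r s ⊗[𝕜] H s t))

/-- The algebra `𝓐 s t` of operators on the global space, for finite `s < t`: the image of
`1 ⊗ B(H s t) ⊗ 1` under `H (-∞) s ⊗ H s t ⊗ H t ∞ → H (-∞) ∞`. Its elements are the bounded
operators `T` such that, for some bounded `A` on `H s t`, `T (f g k) = f (A g) k` for all
`f`, `g`, `k` (the vectors `f g k` are total, so that `A` determines `T`). -/
def localAlgebra (P : ContinuousProduct 𝕜 H) {s t : ℝ} (hst : s < t) :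
    Set (H ⊥ ⊤ →L[𝕜] H ⊥ ⊤) :=
  {T | ∃ A : H s t →L[𝕜] H s t, ∀ (f : H ⊥ s) (g : H s t) (k : H t ⊤),
    T (P.mul (EReal.bot_lt_coe t) (EReal.coe_lt_top t)
        (P.mul (EReal.bot_lt_coe s) (EReal.coe_lt_coe_iff.2 hst) f g) k) =
      P.mul (EReal.bot_lt_coe t) (EReal.coe_lt_top t)
        (P.mul (EReal.bot_lt_coe s) (EReal.coe_lt_coe_iff.2 hst) f (A g)) k}

/-- The non-zero vector `f ∈ H r t` factorizes at every intermediate time. -/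
def IsDecomposable (P : ContinuousProduct 𝕜 H) {r t : EReal} (f : H r t) : Prop :=
  f ≠ 0 ∧ ∀ (s : EReal) (hrs : r < s) (hst : s < t),
    ∃ (g : H r s) (h : H s t), f = P.mul hrs hst g h

end ContinuousProduct

/-- A homogeneous continuous product of Hilbert spaces. The shift
`θ^h_{s,t} : H s t → H (s + h) (t + h)` is written with names `s'`, `t'` for the shifted times,
together with proofs of `s' = s + h`, `t' = t + h`; recall `⊥ + h = ⊥` and `⊤ + h = ⊤` in `EReal`. -/
structure HomogeneousContinuousProduct (𝕜 : Type*) [RCLike 𝕜] (H : EReal → EReal → Type*)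
    [∀ s t, NormedAddCommGroup (H s t)] [∀ s t, InnerProductSpace 𝕜 (H s t)]
    [∀ s t, CompleteSpace (H s t)] extends ContinuousProduct 𝕜 H where
  /-- the unitary shift operators -/
  shift : ∀ (h : ℝ) {s t s' t' : EReal}, s < t → s' = s + (h : EReal) → t' = t + (h : EReal) →
    (H s t ≃ₗᵢ[𝕜] H s' t')
  /-- `θ^h_{r,s} ⊗ θ^h_{s,t} = θ^h_{r,t}` -/
  shift_mul : ∀ (h : ℝ) {r s t r' s' t' : EReal} (hrs : r < s) (hst : s < t)
    (hr : r' = r + (h : EReal)) (hs : s' = s + (h : EReal)) (ht : t' = t + (h : EReal))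
    (hrs' : r' < s') (hst' : s' < t') (f : H r s) (g : H s t),
    shift h (hrs.trans hst) hr ht (toContinuousProduct.mul hrs hst f g) =
      toContinuousProduct.mul hrs' hst' (shift h hrs hr hs f) (shift h hst hs ht g)
  /-- `θ^{h₂}_{s+h₁,t+h₁} θ^{h₁}_{s,t} = θ^{h₁+h₂}_{s,t}` -/
  shift_shift : ∀ (h₁ h₂ : ℝ) {s t s' t' s'' t'' : EReal} (hst : s < t) (hst' : s' < t')
    (hs : s' = s + (h₁ : EReal)) (ht : t' = t + (h₁ : EReal))
    (hs' : s'' = s' + (h₂ : EReal)) (ht' : t'' = t' + (h₂ : EReal))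
    (hs'' : s'' = s + ((h₁ + h₂ : ℝ) : EReal)) (ht'' : t'' = t + ((h₁ + h₂ : ℝ) : EReal))
    (f : H s t),
    shift h₂ hst' hs' ht' (shift h₁ hst hs ht f) = shift (h₁ + h₂) hst hs'' ht'' f
  /-- `θ^h_{-∞,∞} = exp (i h X)` for a self-adjoint operator `X`. It is written through the
  skew-adjoint operator `A = i X`, which makes sense over `ℝ` too. -/
  exists_generator : ∃ A : H ⊥ ⊤ →ₗ.[𝕜] H ⊥ ⊤, IsSkewAdjointOperator A ∧
    IsExpGroup A fun h : ℝ => shift h (s := ⊥) (t := ⊤) (s' := ⊥) (t' := ⊤)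
      bot_lt_top (EReal.bot_add _).symm (EReal.top_add_coe h).symm
  /-- The algebra of all bounded operators on the global space is the closure, in the weak operator
  topology, of the union of the algebras `𝓐 s t`, `-∞ < s < t < ∞`. -/
  dense_localAlgebra :
    Dense (ContinuousLinearMapWOT.ofCLM ''
      (⋃ (s : ℝ) (t : ℝ) (hst : s < t), toContinuousProduct.localAlgebra hst) :
      Set (H ⊥ ⊤ →WOT[𝕜] H ⊥ ⊤))

namespace HomogeneousContinuousProduct

variable {𝕜 : Type*} [RCLike 𝕜] {H : EReal → EReal → Type*}
  [∀ s t, NormedAddCommGroup (H s t)] [∀ s t, InnerProductSpace 𝕜 (H s t)]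
  [∀ s t, CompleteSpace (H s t)]

/-- The shifts `θ^h = θ^h_{-∞,∞}` of the global space. -/
def globalShift (P : HomogeneousContinuousProduct 𝕜 H) (h : ℝ) : H ⊥ ⊤ ≃ₗᵢ[𝕜] H ⊥ ⊤ :=
  P.shift h bot_lt_top (EReal.bot_add _).symm (EReal.top_add_coe h).symm

/-- Invariance under the group of global shifts. -/
def IsShiftInvariant (P : HomogeneousContinuousProduct 𝕜 H) (f : H ⊥ ⊤) : Prop :=
  ∀ h : ℝ, P.globalShift h f = f

/-- The subspace of the global space spanned by all shift-invariant decomposable vectors. -/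
def invariantDecomposableSpan (P : HomogeneousContinuousProduct 𝕜 H) : Submodule 𝕜 (H ⊥ ⊤) :=
  Submodule.span 𝕜 {f | P.IsDecomposable f ∧ P.IsShiftInvariant f}

end HomogeneousContinuousProduct

end

namespace ContinuousProduct

variable {𝕜 : Type*} [RCLike 𝕜] {H : EReal → EReal → Type*}
  [∀ s t, NormedAddCommGroup (H s t)] [∀ s t, InnerProductSpace 𝕜 (H s t)]
  [∀ s t, CompleteSpace (H s t)] (P : ContinuousProduct 𝕜 H)

/-! Let `f₁`, `f₂` be shift-invariant and decomposable, with past components `g₁ s`, `g₂ s` on `(-∞,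
s)`. Factorizations are unique up to scalars (`exists_smul_of_mul_eq`), so `gᵢ t` is proportional to
the shift of `gᵢ s`, and the normalized overlap of `g₁ s` and `g₂ s` does not depend on `s`
(`norm_inner_past`). But `gᵢ t = gᵢ s mᵢ` with `mᵢ` on `(s, t)` (`exists_middle`), so this overlap
is also multiplicative. Hence it vanishes at all times, or every pair `m₁`, `m₂` has normalized
overlap `1` and is proportional.

In the first case `⟪f₁, T f₂⟫ = 0` for every local `T`; in the second `f₁` and `f₂` define the same
normalized state on local operators. By weak density (`eq_of_eqOn_localAlgebra`) either conclusion
extends to all bounded operators. A rank-one operator refutes the first, and the second forces `f₁`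
and `f₂` to be proportional. -/

theorem inner_mul_mul {r s t : EReal} (hrs : r < s) (hst : s < t)
    (f f' : H r s) (g g' : H s t) :
    inner 𝕜 (P.mul hrs hst f g) (P.mul hrs hst f' g') = inner 𝕜 f f' * inner 𝕜 g g' := by
  simp only [mul, LinearIsometryEquiv.inner_map_map, UniformSpace.Completion.inner_coe,
    TensorProduct.inner_tmul]

theorem norm_mul {r s t : EReal} (hrs : r < s) (hst : s < t) (f : H r s) (g : H s t) :
    ‖P.mul hrs hst f g‖ = ‖f‖ * ‖g‖ := by
  simp only [mul, LinearIsometryEquiv.norm_map, UniformSpace.Completion.norm_coe,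
    TensorProduct.norm_tmul]

theorem mul_ne_zero_iff {r s t : EReal} (hrs : r < s) (hst : s < t) (f : H r s) (g : H s t) :
    P.mul hrs hst f g ≠ 0 ↔ f ≠ 0 ∧ g ≠ 0 := by
  rw [← norm_ne_zero_iff, norm_mul, _root_.mul_ne_zero_iff, norm_ne_zero_iff, norm_ne_zero_iff]

theorem add_mul {r s t : EReal} (hrs : r < s) (hst : s < t) (f f' : H r s) (g : H s t) :
    P.mul hrs hst (f + f') g = P.mul hrs hst f g + P.mul hrs hst f' g := by
  simp only [mul, TensorProduct.add_tmul, UniformSpace.Completion.coe_add, map_add]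

theorem smul_mul {r s t : EReal} (hrs : r < s) (hst : s < t) (c : 𝕜) (f : H r s) (g : H s t) :
    P.mul hrs hst (c • f) g = c • P.mul hrs hst f g := by
  simp only [mul, ← TensorProduct.smul_tmul', UniformSpace.Completion.coe_smul, map_smul]

theorem mul_assoc {r s t u : EReal} (hrs : r < s) (hst : s < t) (htu : t < u)
    (f : H r s) (g : H s t) (h : H t u) :
    P.mul (hrs.trans hst) htu (P.mul hrs hst f g) h =
      P.mul hrs (hst.trans htu) f (P.mul hst htu g h) :=
  P.assoc hrs hst htu f g h

/-- The products `a b` are total. -/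
theorem ext_inner_mul {r s t : EReal} (hrs : r < s) (hst : s < t) {x y : H r t}
    (h : ∀ (a : H r s) (b : H s t),
      inner 𝕜 (P.mul hrs hst a b) x = inner 𝕜 (P.mul hrs hst a b) y) : x = y := by
  refine ext_inner_left 𝕜 fun v => ?_
  obtain ⟨w, rfl⟩ := (P.mulIso hrs hst).surjective v
  induction w using UniformSpace.Completion.induction_on with
  | hp =>
    exact isClosed_eq ((P.mulIso hrs hst).continuous.inner continuous_const)
      ((P.mulIso hrs hst).continuous.inner continuous_const)
  | ih w =>
    induction w using TensorProduct.induction_on with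
    | zero => rw [UniformSpace.Completion.coe_zero, map_zero, inner_zero_left, inner_zero_left]
    | tmul a b => exact h a b
    | add w w' hw hw' =>
      simp only [UniformSpace.Completion.coe_add, map_add, inner_add_left, hw, hw']

/-- Multiplication on the right by a fixed vector. -/
noncomputable def mulRight {r s t : EReal} (hrs : r < s) (hst : s < t) (g : H s t) : H r s →L[𝕜] H r t :=
  LinearMap.mkContinuous
    { toFun := fun f => P.mul hrs hst f g
      map_add' := fun f f' => P.add_mul hrs hst f f' g
      map_smul' := fun c f => P.smul_mul hrs hst c f g }
    ‖g‖ fun f => (P.norm_mul hrs hst f g).le.trans_eq (mul_comm _ _)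

theorem mulRight_apply {r s t : EReal} (hrs : r < s) (hst : s < t) (g : H s t) (f : H r s) :
    P.mulRight hrs hst g f = P.mul hrs hst f g := rfl

/-- Factorizations at two times have a common refinement. -/
theorem exists_eq_mul_of_mul_eq {r s t u : EReal} (hrs : r < s) (hst : s < t) (htu : t < u)
    {g : H r s} {h : H s u} {g' : H r t} {h' : H t u} (hh' : h' ≠ 0)
    (e : P.mul hrs (hst.trans htu) g h = P.mul (hrs.trans hst) htu g' h') :
    ∃ m : H s t, g' = P.mul hrs hst g m := by
  have hc : inner 𝕜 h' h' ≠ 0 := inner_self_ne_zero.2 hh'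
  -- Contracting `g h = g' h'` with `h'` on `(t, u)` leaves `g` times the contraction of `h` on one
  -- side and `⟪h', h'⟫ g'` on the other.
  refine ⟨(inner 𝕜 h' h')⁻¹ • (P.mulRight hst htu h').adjoint h, P.ext_inner_mul hrs hst ?_⟩
  intro a b
  rw [inner_mul_mul, inner_smul_right, ContinuousLinearMap.adjoint_inner_right, mulRight_apply]
  have := P.inner_mul_mul hrs (hst.trans htu) a g (P.mul hst htu b h') h
  rw [e, ← mul_assoc, inner_mul_mul] at this
  rw [mul_left_comm, ← this]
  field_simp

/-- A factorization is unique up to scalar factors. -/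
theorem exists_smul_of_mul_eq {r s t : EReal} (hrs : r < s) (hst : s < t)
    {g g' : H r s} {h h' : H s t} (h0 : P.mul hrs hst g h ≠ 0)
    (e : P.mul hrs hst g h = P.mul hrs hst g' h') : ∃ c : 𝕜, c ≠ 0 ∧ g' = c • g := by
  obtain ⟨hg, hh⟩ := (P.mul_ne_zero_iff hrs hst g h).1 h0
  obtain ⟨hg', hh'⟩ := (P.mul_ne_zero_iff hrs hst g' h').1 (e ▸ h0)
  -- Equality case of Cauchy–Schwarz: the product of the two overlaps attains the product of their
  -- two bounds, so each overlap attains its own.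
  refine (norm_inner_eq_norm_iff hg hg').1 (le_antisymm (norm_inner_le_norm g g') ?_)
  have key : ‖inner 𝕜 g g'‖ * ‖inner 𝕜 h h'‖ = (‖g‖ * ‖g'‖) * (‖h‖ * ‖h'‖) := by
    rw [← _root_.norm_mul, ← P.inner_mul_mul hrs hst, ← e, norm_inner_eq_norm_iff h0 h0 |>.2
      ⟨1, one_ne_zero, (one_smul _ _).symm⟩]
    nth_rewrite 2 [e]
    rw [norm_mul, norm_mul]
    ring
  refine le_of_mul_le_mul_right (key.symm.le.trans ?_)
    (mul_pos (norm_pos_iff.2 hh) (norm_pos_iff.2 hh'))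
  exact mul_le_mul_of_nonneg_left (norm_inner_le_norm h h') (norm_nonneg _)

/-- The components of a decomposable vector of the global space on the three intervals given by two
intermediate times. -/
theorem exists_middle {f : H ⊥ ⊤} (hf : f ≠ 0) {s t : ℝ} (hst : s < t)
    {g : H ⊥ s} {h : H s ⊤} {g' : H ⊥ t} {h' : H t ⊤}
    (e : f = P.mul (EReal.bot_lt_coe s) (EReal.coe_lt_top s) g h)
    (e' : f = P.mul (EReal.bot_lt_coe t) (EReal.coe_lt_top t) g' h') :
    ∃ m : H s t, g' = P.mul (EReal.bot_lt_coe s) (EReal.coe_lt_coe_iff.2 hst) g m := by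
  have hh' := ((P.mul_ne_zero_iff _ _ g' h').1 (e' ▸ hf)).2
  exact P.exists_eq_mul_of_mul_eq _ _ _ hh' (e.symm.trans e')

end ContinuousProduct

namespace HomogeneousContinuousProduct

variable {𝕜 : Type*} [RCLike 𝕜] {H : EReal → EReal → Type*}
  [∀ s t, NormedAddCommGroup (H s t)] [∀ s t, InnerProductSpace 𝕜 (H s t)]
  [∀ s t, CompleteSpace (H s t)] (P : HomogeneousContinuousProduct 𝕜 H)

/-- The past component of a shift-invariant decomposable vector at a time `t` is proportional to
the shifted past component at a time `s`. -/
theorem exists_smul_shift {f : H ⊥ ⊤} (hf : f ≠ 0) (hinv : P.IsShiftInvariant f) {s t : ℝ}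
    (ht : (t : EReal) = s + ((t - s : ℝ) : EReal))
    {g : H ⊥ s} {h : H s ⊤} {g' : H ⊥ t} {h' : H t ⊤}
    (e : f = P.mul (EReal.bot_lt_coe s) (EReal.coe_lt_top s) g h)
    (e' : f = P.mul (EReal.bot_lt_coe t) (EReal.coe_lt_top t) g' h') :
    ∃ c : 𝕜, c ≠ 0 ∧
      g' = c • P.shift (t - s) (EReal.bot_lt_coe s) (EReal.bot_add _).symm ht g := by
  have key := P.shift_mul (t - s) (EReal.bot_lt_coe s) (EReal.coe_lt_top s)
    (EReal.bot_add _).symm ht (EReal.top_add_coe _).symm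
    (EReal.bot_lt_coe t) (EReal.coe_lt_top t) g h
  have hs : P.globalShift (t - s) f = f := hinv (t - s)
  rw [← e] at key
  -- By invariance, the shifted factorization at `s` is a factorization of `f` itself at `t`, so
  -- uniqueness applies.
  have key' := (key.symm.trans hs).trans e'
  exact P.exists_smul_of_mul_eq _ _ (key'.trans e'.symm ▸ hf) key'

/-- The normalized overlap of the past components of two shift-invariant decomposable vectors does
not depend on time. -/
theorem norm_inner_past {f₁ f₂ : H ⊥ ⊤} (hf₁ : f₁ ≠ 0) (hf₂ : f₂ ≠ 0)
    (hinv₁ : P.IsShiftInvariant f₁) (hinv₂ : P.IsShiftInvariant f₂) {s t : ℝ}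
    {g₁ g₂ : H ⊥ s} {h₁ h₂ : H s ⊤} {g₁' g₂' : H ⊥ t} {h₁' h₂' : H t ⊤}
    (e₁ : f₁ = P.mul (EReal.bot_lt_coe s) (EReal.coe_lt_top s) g₁ h₁)
    (e₁' : f₁ = P.mul (EReal.bot_lt_coe t) (EReal.coe_lt_top t) g₁' h₁')
    (e₂ : f₂ = P.mul (EReal.bot_lt_coe s) (EReal.coe_lt_top s) g₂ h₂)
    (e₂' : f₂ = P.mul (EReal.bot_lt_coe t) (EReal.coe_lt_top t) g₂' h₂') :
    ‖inner 𝕜 g₁' g₂'‖ * (‖g₁‖ * ‖g₂‖) = ‖inner 𝕜 g₁ g₂‖ * (‖g₁'‖ * ‖g₂'‖) := by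
  have ht : (t : EReal) = s + ((t - s : ℝ) : EReal) := by
    rw [← EReal.coe_add, add_sub_cancel]
  obtain ⟨c₁, -, rfl⟩ := P.exists_smul_shift hf₁ hinv₁ ht e₁ e₁'
  obtain ⟨c₂, -, rfl⟩ := P.exists_smul_shift hf₂ hinv₂ ht e₂ e₂'
  simp only [inner_smul_left, inner_smul_right, LinearIsometryEquiv.inner_map_map, norm_mul,
    norm_smul, LinearIsometryEquiv.norm_map, RCLike.norm_conj]
  ring

/-- Two combinations of matrix elements that agree on the local algebras agree on all operators. -/
theorem eq_of_eqOn_localAlgebra {c d : 𝕜} {x y x' y' : H ⊥ ⊤}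
    (h : ∀ (s t : ℝ) (hst : s < t), ∀ T ∈ P.localAlgebra hst,
      c * inner 𝕜 x (T y) = d * inner 𝕜 x' (T y')) (T : H ⊥ ⊤ →L[𝕜] H ⊥ ⊤) :
    c * inner 𝕜 x (T y) = d * inner 𝕜 x' (T y') := by
  -- Matrix elements are continuous in the weak operator topology, so the operators satisfying the
  -- identity form a closed set.
  have cont : ∀ (c : 𝕜) (x y : H ⊥ ⊤),
      Continuous fun T : H ⊥ ⊤ →WOT[𝕜] H ⊥ ⊤ => c * inner 𝕜 x (T y) := fun c x y =>
    continuous_const.mul (ContinuousLinearMapWOT.continuous_dual_apply y (innerSL 𝕜 x))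
  have hcl := isClosed_eq (cont c x y) (cont d x' y')
  have hsub := closure_minimal (s := ContinuousLinearMapWOT.ofCLM ''
      (⋃ (s : ℝ) (t : ℝ) (hst : s < t), P.localAlgebra hst)) (by
    rintro _ ⟨T, hT, rfl⟩
    simp only [Set.mem_iUnion] at hT
    obtain ⟨s, t, hst, hT⟩ := hT
    exact h s t hst T hT) hcl
  exact hsub (P.dense_localAlgebra (ContinuousLinearMapWOT.ofCLM T))

/-- Any two shift-invariant decomposable vectors are proportional. -/
theorem exists_eq_smul {f₁ f₂ : H ⊥ ⊤} (hd₁ : P.IsDecomposable f₁) (hd₂ : P.IsDecomposable f₂)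
    (hinv₁ : P.IsShiftInvariant f₁) (hinv₂ : P.IsShiftInvariant f₂) :
    ∃ c : 𝕜, f₂ = c • f₁ := by
  obtain ⟨hf₁, hd₁⟩ := hd₁
  obtain ⟨hf₂, hd₂⟩ := hd₂
  choose g₁ k₁ e₁ using fun s : ℝ => hd₁ s (EReal.bot_lt_coe s) (EReal.coe_lt_top s)
  choose g₂ k₂ e₂ using fun s : ℝ => hd₂ s (EReal.bot_lt_coe s) (EReal.coe_lt_top s)
  have hg₁ : ∀ s, g₁ s ≠ 0 := fun s => ((P.mul_ne_zero_iff _ _ _ (k₁ s)).1 (e₁ s ▸ hf₁)).1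
  have hg₂ : ∀ s, g₂ s ≠ 0 := fun s => ((P.mul_ne_zero_iff _ _ _ (k₂ s)).1 (e₂ s ▸ hf₂)).1
  have hq := fun s t => P.norm_inner_past hf₁ hf₂ hinv₁ hinv₂ (e₁ s) (e₁ t) (e₂ s) (e₂ t)
  -- The matrix elements of a local operator, in terms of the components.
  have hT : ∀ (s t : ℝ) (hst : s < t), ∃ m₁ m₂ : H s t,
      g₁ t = P.mul (EReal.bot_lt_coe s) (EReal.coe_lt_coe_iff.2 hst) (g₁ s) m₁ ∧
      g₂ t = P.mul (EReal.bot_lt_coe s) (EReal.coe_lt_coe_iff.2 hst) (g₂ s) m₂ ∧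
      ∀ T ∈ P.localAlgebra hst, ∃ A : H s t →L[𝕜] H s t,
        inner 𝕜 f₁ (T f₁) = inner 𝕜 (g₁ s) (g₁ s) * inner 𝕜 m₁ (A m₁) * inner 𝕜 (k₁ t) (k₁ t) ∧
        inner 𝕜 f₂ (T f₂) = inner 𝕜 (g₂ s) (g₂ s) * inner 𝕜 m₂ (A m₂) * inner 𝕜 (k₂ t) (k₂ t) ∧
        inner 𝕜 f₁ (T f₂) =
          inner 𝕜 (g₁ s) (g₂ s) * inner 𝕜 m₁ (A m₂) * inner 𝕜 (k₁ t) (k₂ t) := by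
    intro s t hst
    obtain ⟨m₁, hm₁⟩ := P.exists_middle hf₁ hst (e₁ s) (e₁ t)
    obtain ⟨m₂, hm₂⟩ := P.exists_middle hf₂ hst (e₂ s) (e₂ t)
    refine ⟨m₁, m₂, hm₁, hm₂, ?_⟩
    rintro T ⟨A, hA⟩
    have hf₁T := e₁ t
    have hf₂T := e₂ t
    rw [hm₁] at hf₁T
    rw [hm₂] at hf₂T
    refine ⟨A, ?_, ?_, ?_⟩ <;>
    · simp only [hf₁T, hf₂T, hA, ContinuousProduct.inner_mul_mul]
  by_cases h0 : ∃ r, inner 𝕜 (g₁ r) (g₂ r) = 0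
  · obtain ⟨r, h0⟩ := h0
    have hz : ∀ s, inner 𝕜 (g₁ s) (g₂ s) = 0 := fun s => by
      have := hq r s
      rw [h0, norm_zero, zero_mul] at this
      simpa [hg₁ r, hg₂ r] using this
    -- With `d = 0` the identity reads `⟪f₁, T f₂⟫ = 0`; the operator `x ↦ ⟪f₂, x⟫ f₁` contradicts
    -- it.
    have := P.eq_of_eqOn_localAlgebra (c := 1) (d := 0) (x := f₁) (y := f₂) (x' := 0) (y' := 0)
      (fun s t hst T hTm => by
        obtain ⟨m₁, m₂, -, -, hm⟩ := hT s t hst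
        obtain ⟨A, -, -, hA⟩ := hm T hTm
        simp [hA, hz]) (InnerProductSpace.rankOne 𝕜 f₁ f₂)
    simp [inner_smul_right, hf₁, hf₂] at this
  · have hz : ∀ s, inner 𝕜 (g₁ s) (g₂ s) ≠ 0 := not_exists.1 h0
    -- The coefficients clear the denominators in the equality of the normalized states of `f₁` and
    -- `f₂`.
    have := P.eq_of_eqOn_localAlgebra (c := inner 𝕜 f₂ f₂) (d := inner 𝕜 f₁ f₁)
      (x := f₁) (y := f₁) (x' := f₂) (y' := f₂)
      (fun s t hst T hTm => by
        obtain ⟨m₁, m₂, hm₁, hm₂, hm⟩ := hT s t hst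
        obtain ⟨A, hA₁, hA₂, -⟩ := hm T hTm
        have hm₁0 : m₁ ≠ 0 := ((P.mul_ne_zero_iff _ _ _ m₁).1 (hm₁ ▸ hg₁ t)).2
        have hm₂0 : m₂ ≠ 0 := ((P.mul_ne_zero_iff _ _ _ m₂).1 (hm₂ ▸ hg₂ t)).2
        -- The overlap at `t` is the overlap at `s` times that of `m₁`, `m₂`; constancy lets the
        -- nonzero factor at `s` cancel.
        have hmm : ‖inner 𝕜 m₁ m₂‖ = ‖m₁‖ * ‖m₂‖ := by
          have := hq s t
          rw [hm₁, hm₂, ContinuousProduct.inner_mul_mul, ContinuousProduct.norm_mul,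
            ContinuousProduct.norm_mul, norm_mul] at this
          have hne : ‖inner 𝕜 (g₁ s) (g₂ s)‖ * (‖g₁ s‖ * ‖g₂ s‖) ≠ 0 := by
            simp [hz s, hg₁ s, hg₂ s]
          refine mul_left_cancel₀ hne ?_
          linear_combination this
        obtain ⟨c, -, rfl⟩ := (norm_inner_eq_norm_iff hm₁0 hm₂0).1 hmm
        rw [hA₁, hA₂, e₁ t, e₂ t, hm₁, hm₂]
        simp only [ContinuousProduct.inner_mul_mul, inner_smul_left, inner_smul_right, map_smul]
        ring) (InnerProductSpace.rankOne 𝕜 f₁ f₁)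
    simp only [InnerProductSpace.rankOne_apply, inner_smul_right] at this
    have hne : inner 𝕜 f₁ f₁ ≠ 0 := inner_self_ne_zero.2 hf₁
    -- Testing the states on `x ↦ ⟪f₁, x⟫ f₁` gives equality in Cauchy–Schwarz for `f₁`, `f₂`.
    have h2 : inner 𝕜 f₁ f₂ * inner 𝕜 f₂ f₁ = inner 𝕜 f₁ f₁ * inner 𝕜 f₂ f₂ :=
      mul_left_cancel₀ hne (by linear_combination -this)
    have h3 : ‖inner 𝕜 f₁ f₂‖ = ‖f₁‖ * ‖f₂‖ := by
      have := congrArg norm h2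
      rw [norm_mul, norm_mul, norm_inner_symm f₂ f₁, inner_self_eq_norm_sq_to_K,
        inner_self_eq_norm_sq_to_K] at this
      simp only [norm_pow, RCLike.norm_ofReal, abs_norm] at this
      rw [← sq, ← mul_pow] at this
      exact (pow_left_inj₀ (norm_nonneg _) (by positivity) two_ne_zero).1 this
    obtain ⟨c, -, hc⟩ := (norm_inner_eq_norm_iff hf₁ hf₂).1 h3
    exact ⟨c, hc⟩

end HomogeneousContinuousProduct

theorem mainTheorem11 {𝕜 : Type*} [RCLike 𝕜] {H : EReal → EReal → Type*}
    [∀ s t, NormedAddCommGroup (H s t)] [∀ s t, InnerProductSpace 𝕜 (H s t)]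
    [∀ s t, CompleteSpace (H s t)] (P : HomogeneousContinuousProduct 𝕜 H) :
    Module.rank 𝕜 P.invariantDecomposableSpan = 0 ∨
      Module.rank 𝕜 P.invariantDecomposableSpan = 1 := by
  rw [HomogeneousContinuousProduct.invariantDecomposableSpan]
  rcases Set.eq_empty_or_nonempty {f | P.IsDecomposable f ∧ P.IsShiftInvariant f} with h | ⟨f, hf⟩
  · left
    rw [h, Submodule.span_empty, rank_bot]
  · right
    refine (rank_submodule_eq_one_iff _).2
      ⟨f, Submodule.subset_span hf, hf.1.1, Submodule.span_le.2 fun f' hf' => ?_⟩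
    obtain ⟨c, rfl⟩ := P.exists_eq_smul hf.1 hf'.1 hf.2 hf'.2
    exact Submodule.mem_span_singleton.2 ⟨c, rfl⟩
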